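/- For a prime power $q$ let $\mathbb F_q$ be the field with $q$ elements, and let $\mathcal Q$ be the set of prime powers. Let $\mathcal S\subset\mathbb Z[q]$ be the saturated multiplicative system generated by the polynomials $q^n-q$, $n>1$ (that is, all divisors of finite products of such polynomials), and let $\mathsf R=\mathcal S^{-1}\mathbb Z[q]$; elements of $\mathsf R$ are regarded as functions $\mathcal Q\to\mathbb Q$. For a finite simple graph $G$ with vertices $v_1,\dots,v_n$ let $[Z_G]:\mathcal Q\to\mathbb Q$ be the function sending $q$ to the number of nondegenerate symmetric $n\times n$ matrices $M$ over $\mathbb F_q$ such that $M_{ij}=0$ whenever $v_i$ and $v_j$ are joined by an edge. Let $\mathrm{Graphs}_*$ be the $\mathsf R$-submodule of the functions $\mathcal Q\to\mathbb Q$ generated by all $[Z_G]$, $G$ a finite simple graph. Let $G$ be a finite simple graph with vertex set $V$, let $s\ge 0$ be an integer, let $U\subset 2^V$, and let $\pi:U\to\mathbb N$ be any function (a partially defined rank function for $V$). Let $[J_G(s,\pi)]:\mathcal Q\to\mathbb Q$ be the function sending $q$ to the number of pairs $(Q,f)$ where $Q$ is a nondegenerate symmetric bilinear form on $\mathbb F_q^s$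 and $f:V\to\mathbb F_q^s$ is a function such that $Q(f(v),f(w))=0$ whenever $v$ and $w$ are joined by an edge of $G$, and the span of $f(H)$ has dimension $\pi(H)$ for every $H\in U$. Then $[J_G(s,\pi)]\in\mathrm{Graphs}_*$. -/

import Mathlib

noncomputable section

namespace GraphMotives

open Polynomial

/-- The set of prime powers `q = p ^ k`, `k ≥ 1`. -/
abbrev PrimePower : Type := {q : ℕ // IsPrimePow q}

namespace PrimePower

/-- The prime dividing the prime power `q`. -/
def char (q : PrimePower) : ℕ := (q : ℕ).minFac

/-- The exponent `k` in `q = p ^ k`. -/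
def exponent (q : PrimePower) : ℕ := (q : ℕ).factorization (q : ℕ).minFac

instance (q : PrimePower) : Fact q.char.Prime :=
  ⟨Nat.minFac_prime q.2.ne_one⟩

theorem char_pow_exponent (q : PrimePower) : q.char ^ q.exponent = q :=
  q.2.minFac_pow_factorization_eq

/-- The finite field with `q` elements. -/
abbrev Fq (q : PrimePower) : Type := GaloisField q.char q.exponent

theorem exponent_ne_zero (q : PrimePower) : q.exponent ≠ 0 := by
  intro h
  have h1 := q.char_pow_exponent
  rw [h, pow_zero] at h1
  exact q.2.ne_one h1.symm

theorem card_Fq (q : PrimePower) : Nat.card q.Fq = q := by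
  rw [GaloisField.card _ _ q.exponent_ne_zero, char_pow_exponent]

instance (q : PrimePower) : Finite q.Fq :=
  Nat.finite_of_card_ne_zero (by rw [card_Fq]; exact q.2.ne_zero)

end PrimePower

/-- The ring of rational-valued functions on the set of prime powers. -/
abbrev CountFun : Type := PrimePower → ℚ

/-- The saturated multiplicative system in `ℤ[q]` generated by the polynomials `q ^ n - q`,
`n > 1`. -/
def denominators : Submonoid ℤ[X] :=
  (Submonoid.closure {p : ℤ[X] | ∃ n : ℕ, 1 < n ∧ p = X ^ n - X}).saturation.toSubmonoid

/-- A polynomial in `q` as a function on prime powers. -/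
def polyFun : ℤ[X] →+* CountFun :=
  RingHom.pi fun q => Polynomial.eval₂RingHom (Int.castRingHom ℚ) ((q : ℕ) : ℚ)

theorem isUnit_polyFun (m : denominators) : IsUnit (polyFun m) := by
  obtain ⟨m, hm⟩ := m
  obtain ⟨y, hy, hdvd⟩ := Submonoid.mem_saturation_iff_exists_dvd.mp hm
  refine isUnit_of_dvd_unit (map_dvd polyFun hdvd) ?_
  have hle : Submonoid.closure {p : ℤ[X] | ∃ n : ℕ, 1 < n ∧ p = X ^ n - X} ≤
      (IsUnit.submonoid CountFun).comap polyFun := by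
    rw [Submonoid.closure_le]
    rintro _ ⟨n, hn, rfl⟩
    change IsUnit (polyFun (X ^ n - X))
    rw [Pi.isUnit_iff]
    intro q
    have h1 : (1 : ℚ) < ((q : ℕ) : ℚ) := by exact_mod_cast q.2.one_lt
    have h2 : ((q : ℕ) : ℚ) ^ 1 < ((q : ℕ) : ℚ) ^ n := pow_lt_pow_right₀ h1 hn
    have h3 : polyFun (X ^ n - X) q = ((q : ℕ) : ℚ) ^ n - ((q : ℕ) : ℚ) := by
      change Polynomial.eval₂RingHom (Int.castRingHom ℚ) ((q : ℕ) : ℚ) (X ^ n - X) = _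
      simp
    rw [h3, isUnit_iff_ne_zero, sub_ne_zero]
    rw [pow_one] at h2
    exact h2.ne'
  exact hle hy

/-- The localization of `ℤ[q]` at `denominators`. -/
abbrev CoeffRing : Type := Localization denominators

/-- Elements of `CoeffRing` are everywhere-defined functions on prime powers. -/
def coeffFun : CoeffRing →+* CountFun :=
  IsLocalization.lift (M := denominators) (g := polyFun) isUnit_polyFun

/-- `CoeffRing` acts on functions on prime powers by pointwise multiplication. -/
instance : Module CoeffRing CountFun := Module.compHom CountFun coeffFun

section Points

variable (K : Type*) [Field K]

/-- The `K`-points of `Z_G`: nondegenerate symmetric matrices, indexed by the vertices, whose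
entries vanish along the edges of `G`. -/
def ZPoints {V : Type*} [Fintype V] [DecidableEq V] (G : SimpleGraph V) : Set (Matrix V V K) :=
  {M | M.IsSymm ∧ IsUnit M.det ∧ ∀ v w, G.Adj v w → M v w = 0}

/-- The `K`-points of `J_G(s)`: pairs of a nondegenerate symmetric bilinear form `Q` on `K ^ s`
and a function `f : V → K ^ s` with `Q (f v) (f w) = 0` along the edges of `G`. -/
def JPoints {V : Type*} (G : SimpleGraph V) (s : ℕ) :
    Set (LinearMap.BilinForm K (Fin s → K) × (V → Fin s → K)) :=
  {x | x.1.IsSymm ∧ x.1.Nondegenerate ∧ ∀ v w, G.Adj v w → x.1 (x.2 v) (x.2 w) = 0}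

/-- The `K`-points of `J_G(s, π)`, where `π` is a partially defined rank function with domain
`U`: points of `J_G(s)` such that `f` restricted to `H` has rank `π H` for each `H ∈ U`. -/
def JRankPoints {V : Type*} (G : SimpleGraph V) (s : ℕ) {U : Set (Set V)} (π : U → ℕ) :
    Set (LinearMap.BilinForm K (Fin s → K) × (V → Fin s → K)) :=
  {x | x ∈ JPoints K G s ∧
    ∀ H : U, Module.finrank K (Submodule.span K (x.2 '' (H : Set V))) = π H}

end Points

/-- The function `[Z_G] : q ↦ # Z_G(𝔽_q)`. -/
def countZ {V : Type*} [Fintype V] [DecidableEq V] (G : SimpleGraph V) : CountFun :=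
  fun q => (Nat.card (ZPoints q.Fq G) : ℚ)

/-- The function `[J_G(s, π)] : q ↦ # J_G(s, π)(𝔽_q)`. -/
def countJ {V : Type*} (G : SimpleGraph V) (s : ℕ) {U : Set (Set V)} (π : U → ℕ) : CountFun :=
  fun q => (Nat.card (JRankPoints q.Fq G s π) : ℚ)

/-- The module generated over `CoeffRing` by the functions `[Z_G]`, `G` a finite simple graph
(every such graph is isomorphic to one with vertex set `Fin n`). -/
def GraphsStar : Submodule CoeffRing CountFun :=
  Submodule.span CoeffRing {φ | ∃ (n : ℕ) (G : SimpleGraph (Fin n)), φ = countZ G}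

end GraphMotives

end

noncomputable section

namespace GraphMotives

open Polynomial Module

/-! Everything rests on one fact: `qCoeff ^ n - qCoeff ^ k` is invertible for `k < n`. Each
reduction yields a relation whose coefficient on the wanted term is such a unit, up to a power of
`q`. Rank conditions are removed by interpolation. Attach `a H` new vertices to each `H ∈ U`. Since
`Q` is nondegenerate, the vectors at these vertices can be chosen in `∏ (q ^ (s - rk f(H))) ^ a H`
ways (`card_JPoints_attach`). Lagrange polynomials in `q ^ (s - t)` express the indicator of `rk
f(H) = π H`, so `countJ` is a combination of counts `countJFree` without rank conditions
(`countJ_eq_sum`). These are split by the dimension `r` of the span of all vectors. Adding an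
isolated vertex, hence an arbitrary extra vector, expresses the case `r < s` through `r + 1`
(`countSpan_mem`). For `r = s`, a configuration amounts to its Gram matrix, symmetric of rank `s`,
together with a basis of the row space of that matrix (`spanPointsEquiv`). Symmetric matrices of
lower rank are treated alike: an isolated vertex borders the matrix by an arbitrary row and column,
which relates each corank to smaller ones until only nondegenerate matrices remain
(`countRank_mem`). -/

/-! ### The coefficient ring -/

/-- The variable `q` as an element of the coefficient ring. -/
def qCoeff : CoeffRing := algebraMap ℤ[X] CoeffRing X

/-- Evaluation of a coefficient at a prime power. -/
def coeffEval (q : PrimePower) : CoeffRing →+* ℚ := (Pi.evalRingHom _ q).comp coeffFun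

theorem coeffEval_qCoeff (q : PrimePower) : coeffEval q qCoeff = (q : ℕ) := by
  change coeffFun (algebraMap ℤ[X] CoeffRing X) q = _
  rw [coeffFun, IsLocalization.lift_eq]
  change Polynomial.eval₂RingHom (Int.castRingHom ℚ) ((q : ℕ) : ℚ) X = _
  simp

theorem coeff_smul_apply (c : CoeffRing) (φ : CountFun) (q : PrimePower) :
    (c • φ) q = coeffEval q c * φ q := rfl

/-- Saturation is what matters here: the polynomial divides `(X ^ 2 - X) ^ k * (X ^ (n - k + 1) -
X)`, with cofactor `(X - 1) ^ k * X`. -/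
theorem isUnit_qCoeff_pow_sub_pow {k n : ℕ} (h : k < n) : IsUnit (qCoeff ^ n - qCoeff ^ k) := by
  have hgen : ∀ m, 1 < m → (X ^ m - X : ℤ[X]) ∈
      Submonoid.closure {p : ℤ[X] | ∃ n : ℕ, 1 < n ∧ p = X ^ n - X} :=
    fun m hm => Submonoid.subset_closure ⟨m, hm, rfl⟩
  have hmem : (X ^ n - X ^ k : ℤ[X]) ∈ denominators := by
    refine Submonoid.mem_saturation_iff_exists_dvd.mpr
      ⟨(X ^ 2 - X) ^ k * (X ^ (n - k + 1) - X), ?_, ?_⟩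
    · exact mul_mem (pow_mem (hgen 2 one_lt_two) k) (hgen (n - k + 1) (by omega))
    · obtain ⟨d, rfl⟩ := Nat.exists_eq_add_of_lt h
      refine ⟨(X - 1) ^ k * X, ?_⟩
      have h1 : k + d + 1 - k + 1 = d + 1 + 1 := by omega
      rw [h1, show (X ^ 2 - X : ℤ[X]) = X * (X - 1) by ring, mul_pow]
      ring
  have := IsLocalization.map_units CoeffRing (⟨_, hmem⟩ : denominators)
  simpa [qCoeff] using this

theorem isUnit_qCoeff : IsUnit qCoeff := by
  refine isUnit_of_dvd_unit ⟨qCoeff - 1, ?_⟩ (isUnit_qCoeff_pow_sub_pow one_lt_two)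
  ring

theorem mem_GraphsStar_of_isUnit_smul {c : CoeffRing} (hc : IsUnit c) {φ : CountFun}
    (h : c • φ ∈ GraphsStar) : φ ∈ GraphsStar :=
  (Submodule.smul_mem_iff_of_isUnit _ hc).mp h

/-- Lagrange basis polynomials for the nodes `q ^ 0, …, q ^ s` have coefficients in `CoeffRing`
because differences of distinct nodes are units. -/
theorem exists_lagrange (s r : ℕ) : ∃ P : CoeffRing[X], ∀ t ≤ s,
    P.eval (qCoeff ^ t) = if t = r then 1 else 0 := by
  have hu : ∀ j, j ≠ r → ∃ u, u * (qCoeff ^ r - qCoeff ^ j) = 1 := by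
    intro j hj
    rcases lt_or_gt_of_ne hj with h | h
    · exact (isUnit_qCoeff_pow_sub_pow h).exists_left_inv
    · have := (isUnit_qCoeff_pow_sub_pow h).neg
      rw [neg_sub] at this
      exact this.exists_left_inv
  choose! u hu using hu
  refine ⟨∏ j ∈ (Finset.range (s + 1)).erase r, C (u j) * (X - C (qCoeff ^ j)), fun t ht => ?_⟩
  rw [eval_prod]
  split_ifs with h
  · subst h
    refine Finset.prod_eq_one fun j hj => ?_
    simpa using hu j (Finset.ne_of_mem_erase hj)
  · refine Finset.prod_eq_zero (i := t) (by simp [h]; omega) ?_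
    simp

/-! ### Counting -/

theorem card_subtype_prod {α β : Type*} [Finite β] (P : α → Prop)
    [Fintype {a // P a}] (R : α → β → Prop) :
    Nat.card {x : α × β // P x.1 ∧ R x.1 x.2} = ∑ a : {a // P a}, Nat.card {b // R a b} := by
  rw [← Nat.card_sigma]
  exact Nat.card_congr
    { toFun := fun x => ⟨⟨x.1.1, x.2.1⟩, ⟨x.1.2, x.2.2⟩⟩
      invFun := fun x => ⟨(x.1.1, x.2.1), x.1.2, x.2.2⟩
      left_inv := fun _ => rfl
      right_inv := fun _ => rfl }

theorem card_subtype_prod_of_const {α β : Type*} [Finite α] [Finite β] (P : α → Prop)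
    (R : α → β → Prop) (c : ℕ) (h : ∀ a, P a → Nat.card {b // R a b} = c) :
    Nat.card {x : α × β // P x.1 ∧ R x.1 x.2} = Nat.card {a // P a} * c := by
  have := Fintype.ofFinite {a // P a}
  rw [card_subtype_prod, Finset.sum_congr rfl fun (a : {a // P a}) _ => h a a.2, Finset.sum_const,
    Finset.card_univ, Nat.card_eq_fintype_card, smul_eq_mul]

theorem sum_subtype_ite {α : Type*} (P : α → Prop) [Fintype {a // P a}] (Q : α → Prop)
    [DecidablePred Q] (c : ℚ) :
    ∑ a : {a // P a}, (if Q a then c else 0) = c * Nat.card {a // P a ∧ Q a} := by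
  rw [← Finset.sum_filter, Finset.sum_const, nsmul_eq_mul, mul_comm]
  congr 2
  rw [← Nat.card_congr (Equiv.subtypeSubtypeEquivSubtypeInter P Q), Nat.card_eq_fintype_card,
    Fintype.card_subtype]

section LinearAlgebra

variable {K E : Type*} [Field K] [AddCommGroup E] [Module K E]

theorem finrank_span_insert [FiniteDimensional K E] (S : Set E) (x : E)
    [Decidable (x ∈ Submodule.span K S)] :
    finrank K (Submodule.span K (insert x S)) =
      finrank K (Submodule.span K S) + if x ∈ Submodule.span K S then 0 else 1 := by
  split_ifs with h
  · rw [Submodule.span_insert_eq_span h, add_zero]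
  · have hx : x ≠ 0 := fun h0 => h (h0 ▸ zero_mem _)
    have h1 := Submodule.finrank_sup_add_finrank_inf_eq (Submodule.span K {x}) (Submodule.span K S)
    have h2 : Submodule.span K {x} ⊓ Submodule.span K S = ⊥ :=
      ((Submodule.disjoint_span_singleton' hx).mpr h).symm.eq_bot
    rw [h2, finrank_bot, finrank_span_singleton hx] at h1
    rw [Submodule.span_insert]
    omega

end LinearAlgebra

/-! ### Symmetric matrices of given rank -/

section Border

variable {K V : Type*} [Field K]

/-- The symmetric matrix `M` bordered by the vector `b` and the scalar `c`. -/
def border (M : Matrix V V K) (b : V → K) (c : K) : Matrix (Option V) (Option V) K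
  | some v, some w => M v w
  | some v, none => b v
  | none, some w => b w
  | none, none => c

/-- The matrix `M` with the column `b` appended. -/
def appendCol (M : Matrix V V K) (b : V → K) : Matrix V (Option V) K
  | v, some w => M v w
  | v, none => b v

variable [Fintype V] {M : Matrix V V K} {b : V → K} {c : K}

open Classical in
theorem rank_appendCol (M : Matrix V V K) (b : V → K) :
    (appendCol M b).rank = M.rank + if ∃ x, M.mulVec x = b then 0 else 1 := by
  have h : b ∈ Submodule.span K (Set.range M.col) ↔ ∃ x, M.mulVec x = b := by
    rw [← Matrix.range_mulVecLin]; rfl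
  rw [Matrix.rank_eq_finrank_span_cols, Matrix.rank_eq_finrank_span_cols, Option.range_eq]
  change finrank K (Submodule.span K (insert b (Set.range M.col))) = _
  simp only [finrank_span_insert, h]

open Classical in
theorem rank_border (M : Matrix V V K) (b : V → K) (c : K) :
    (border M b c).rank = (appendCol M b).rank +
      if ∃ y, Matrix.vecMul y M = b ∧ y ⬝ᵥ b = c then 0 else 1 := by
  have h : border M b c none ∈ Submodule.span K (Set.range (appendCol M b).row) ↔
      ∃ y, Matrix.vecMul y M = b ∧ y ⬝ᵥ b = c := by
    rw [← range_vecMulLinear]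
    refine exists_congr fun y => ⟨fun h => ⟨?_, ?_⟩, fun h => ?_⟩
    · ext w; exact congrFun h (some w)
    · exact congrFun h none
    · ext (_ | w)
      · exact h.2
      · exact congrFun h.1 w
  rw [Matrix.rank_eq_finrank_span_row, Matrix.rank_eq_finrank_span_row (appendCol M b),
    Option.range_eq, show (border M b c).row ∘ some = (appendCol M b).row by
      ext v (_ | w) <;> rfl]
  change finrank K (Submodule.span K (insert (border M b c none)
    (Set.range (appendCol M b).row))) = _
  simp only [finrank_span_insert, h]

/-- By symmetry `b` lies outside the row space too, so the new column and the new row each raise the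
rank. -/
theorem rank_border_of_notMem (hM : M.IsSymm) (hb : ¬ ∃ x, M.mulVec x = b) :
    (border M b c).rank = M.rank + 2 := by
  rw [rank_border, rank_appendCol, if_neg hb, if_neg]
  rintro ⟨y, hy, -⟩
  exact hb ⟨y, by rw [← hy, ← Matrix.mulVec_transpose, hM.eq]⟩

open Classical in
-- Symmetry makes `y ⬝ᵥ b` the same for all solutions `y` of `M y = b`, so exactly one corner entry
-- leaves the rank unchanged.
theorem rank_border_of_mulVec_eq (hM : M.IsSymm) {x : V → K} (hx : M.mulVec x = b) :
    (border M b c).rank = M.rank + if c = x ⬝ᵥ b then 0 else 1 := by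
  rw [rank_border, rank_appendCol, if_pos ⟨x, hx⟩, add_zero]
  congr 2
  apply propext
  constructor
  · rintro ⟨y, hy, rfl⟩
    nth_rw 1 [← hx]
    rw [Matrix.dotProduct_mulVec, hy, dotProduct_comm]
  · rintro rfl
    exact ⟨x, by rw [← Matrix.mulVec_transpose, hM.eq, hx], rfl⟩

end Border

/-! ### Counting the borders of a symmetric matrix by resulting rank -/

section Count

variable {K V : Type*} [Field K] [Fintype V]

theorem card_range_mulVec (M : Matrix V V K) :
    Nat.card {b // ∃ x, M.mulVec x = b} = Nat.card K ^ M.rank :=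
  Module.natCard_eq_pow_finrank (K := K) (V := LinearMap.range M.mulVecLin)

theorem card_notMem {α : Type*} [Finite α] (P : α → Prop) :
    Nat.card {a // ¬ P a} = Nat.card α - Nat.card {a // P a} := by
  classical
  have := Fintype.ofFinite α
  simp only [Nat.card_eq_fintype_card, Fintype.card_subtype_compl]

/-- For `b` in the column space, one value of `c` keeps the rank and the others raise it by 1. For
`b` outside, every `c` raises it by 2. The column space has `q ^ M.rank` elements. -/
theorem card_rank_border [Finite K] {M : Matrix V V K} (hM : M.IsSymm) (k : ℕ) :
    (Nat.card {p : (V → K) × K // (border M p.1 p.2).rank = k + 2} : ℚ) =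
      (if M.rank = k + 2 then (Nat.card K : ℚ) ^ (k + 2) else 0) +
      (if M.rank = k + 1 then (Nat.card K : ℚ) ^ (k + 1) * (Nat.card K - 1) else 0) +
      (if M.rank = k then
        ((Nat.card K : ℚ) ^ Fintype.card V - (Nat.card K : ℚ) ^ k) * Nat.card K else 0) := by
  classical
  -- This tautology lets `choose!` produce a total solution function, with junk values off the
  -- column space.
  have hx : ∀ b, (∃ x, M.mulVec x = b) → ∃ x, M.mulVec x = b := fun _ h => h
  choose! x hx using hx
  have hrank : ∀ p : (V → K) × K, (border M p.1 p.2).rank = M.rank +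
      if ∃ y, M.mulVec y = p.1 then if p.2 = x p.1 ⬝ᵥ p.1 then 0 else 1 else 2 := by
    intro p
    split_ifs with hb hc
    · rw [rank_border_of_mulVec_eq hM (hx _ hb), if_pos hc]
    · rw [rank_border_of_mulVec_eq hM (hx _ hb), if_neg hc]
    · rw [rank_border_of_notMem hM hb]
  have hone : 1 ≤ Nat.card K := Nat.card_pos
  by_cases h2 : M.rank = k + 2
  · have h : ∀ p : (V → K) × K, (border M p.1 p.2).rank = k + 2 ↔
        (∃ y, M.mulVec y = p.1) ∧ p.2 = x p.1 ⬝ᵥ p.1 := by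
      intro p
      rw [hrank, h2]
      split_ifs <;> simp_all
    rw [Nat.card_congr (Equiv.subtypeEquivRight h),
      card_subtype_prod_of_const (fun b => ∃ y, M.mulVec y = b) (fun b c => c = x b ⬝ᵥ b) 1
        (by simp), card_range_mulVec]
    simp [h2]
  by_cases h1 : M.rank = k + 1
  · have h : ∀ p : (V → K) × K, (border M p.1 p.2).rank = k + 2 ↔
        (∃ y, M.mulVec y = p.1) ∧ ¬ p.2 = x p.1 ⬝ᵥ p.1 := by
      intro p
      rw [hrank, h1]
      split_ifs <;> simp_all
    rw [Nat.card_congr (Equiv.subtypeEquivRight h),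
      card_subtype_prod_of_const (fun b => ∃ y, M.mulVec y = b) (fun b c => ¬ c = x b ⬝ᵥ b)
        (Nat.card K - 1) (by simp [card_notMem]), card_range_mulVec]
    simp [h1, hone]
  by_cases h0 : M.rank = k
  · have h : ∀ p : (V → K) × K, (border M p.1 p.2).rank = k + 2 ↔
        (¬ ∃ y, M.mulVec y = p.1) ∧ True := by
      intro p
      rw [hrank, h0]
      split_ifs <;> simp_all
    have hle : Nat.card K ^ M.rank ≤ Nat.card K ^ Fintype.card V :=
      Nat.pow_le_pow_right hone M.rank_le_card_width
    rw [Nat.card_congr (Equiv.subtypeEquivRight h),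
      card_subtype_prod_of_const (fun b => ¬ ∃ y, M.mulVec y = b) (fun _ _ => True) (Nat.card K)
        (by simp [Nat.card_congr (Equiv.subtypeUnivEquiv _)]), card_notMem, card_range_mulVec,
        Nat.card_fun, Nat.card_eq_fintype_card (α := V), Nat.cast_mul, Nat.cast_sub hle]
    simp [h0]
  · have h : ∀ p : (V → K) × K, (border M p.1 p.2).rank ≠ k + 2 := by
      intro p
      rw [hrank]
      split_ifs <;> omega
    simp [h, h0, h1, h2]

end Count

/-! ### Bordering as the addition of an isolated vertex -/

section RankPoints

variable (K : Type*) [Field K] {V : Type*}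

/-- Symmetric matrices vanishing along the edges of `G`. -/
def symPoints (G : SimpleGraph V) : Set (Matrix V V K) :=
  {M | M.IsSymm ∧ ∀ v w, G.Adj v w → M v w = 0}

/-- Symmetric matrices of rank `k` vanishing along the edges of `G`. -/
def rankPoints [Fintype V] (G : SimpleGraph V) (k : ℕ) : Set (Matrix V V K) :=
  {M | M ∈ symPoints K G ∧ M.rank = k}

/-- The graph `G` with one isolated vertex added. -/
def addIsolated (G : SimpleGraph V) : SimpleGraph (Option V) := G.map Function.Embedding.some

theorem addIsolated_adj_forall (G : SimpleGraph V) (P : Option V → Option V → Prop) :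
    (∀ v w, (addIsolated G).Adj v w → P v w) ↔ ∀ v w, G.Adj v w → P (some v) (some w) := by
  simp only [addIsolated, SimpleGraph.map_adj]
  constructor
  · exact fun h v w hvw => h _ _ ⟨v, w, hvw, rfl, rfl⟩
  · rintro h _ _ ⟨v, w, hvw, rfl, rfl⟩
    exact h v w hvw

theorem border_mem_symPoints {G : SimpleGraph V} {M : Matrix V V K} {b : V → K} {c : K} :
    border M b c ∈ symPoints K (addIsolated G) ↔ M ∈ symPoints K G := by
  refine and_congr ?_ (addIsolated_adj_forall G fun v w => border M b c v w = 0)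
  simp only [Matrix.IsSymm.ext_iff]
  constructor
  · exact fun h v w => h (some v) (some w)
  · rintro h (_ | v) (_ | w)
    exacts [rfl, rfl, rfl, h v w]

/-- Removing the last row and column of a symmetric matrix vanishing along edges. -/
def rankPointsAddIsolatedEquiv [Fintype V] (G : SimpleGraph V) (k : ℕ) :
    rankPoints K (addIsolated G) k ≃
      {x : Matrix V V K × ((V → K) × K) // x.1 ∈ symPoints K G ∧
        (border x.1 x.2.1 x.2.2).rank = k} :=
  have key : ∀ N : Matrix (Option V) (Option V) K, N.IsSymm →
      border (N.submatrix some some) (fun v => N (some v) none) (N none none) = N := by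
    intro N hN
    ext (_ | v) (_ | w)
    exacts [rfl, hN.apply _ _, rfl, rfl]
  { toFun := fun N => ⟨(N.1.submatrix some some, fun v => N.1 (some v) none, N.1 none none), by
      rw [← border_mem_symPoints, key _ N.2.1.1]
      exact N.2⟩
    invFun := fun x => ⟨border x.1.1 x.1.2.1 x.1.2.2, (border_mem_symPoints K).2 x.2.1, x.2.2⟩
    left_inv := fun N => Subtype.ext (key _ N.2.1.1)
    right_inv := fun _ => rfl }

theorem card_rankPoints_addIsolated [Finite K] [Fintype V] (G : SimpleGraph V) (k : ℕ) :
    (Nat.card (rankPoints K (addIsolated G) (k + 2)) : ℚ) =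
      (Nat.card K : ℚ) ^ (k + 2) * Nat.card (rankPoints K G (k + 2)) +
      (Nat.card K : ℚ) ^ (k + 1) * (Nat.card K - 1) * Nat.card (rankPoints K G (k + 1)) +
      ((Nat.card K : ℚ) ^ Fintype.card V - (Nat.card K : ℚ) ^ k) * Nat.card K *
        Nat.card (rankPoints K G k) := by
  classical
  have := Fintype.ofFinite {M : Matrix V V K // M ∈ symPoints K G}
  rw [Nat.card_congr (rankPointsAddIsolatedEquiv K G (k + 2)),
    card_subtype_prod _ (fun M (p : (V → K) × K) => (border M p.1 p.2).rank = k + 2),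
    Nat.cast_sum, Finset.sum_congr rfl fun M _ => card_rank_border M.2.1 k,
    Finset.sum_add_distrib, Finset.sum_add_distrib,
    sum_subtype_ite _ (fun M : Matrix V V K => M.rank = k + 2),
    sum_subtype_ite _ (fun M : Matrix V V K => M.rank = k + 1),
    sum_subtype_ite _ (fun M : Matrix V V K => M.rank = k)]
  rfl

/-- The function counting symmetric matrices of rank `k` vanishing along the edges of `G`. -/
def countRank [Fintype V] (G : SimpleGraph V) (k : ℕ) : CountFun :=
  fun q => (Nat.card (rankPoints q.Fq G k) : ℚ)

/-- The last coefficient is a unit for `k < Fintype.card V`, so the relation can be solved for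
`countRank G k`. -/
theorem countRank_addIsolated [Fintype V] (G : SimpleGraph V) (k : ℕ) :
    countRank (addIsolated G) (k + 2) =
      qCoeff ^ (k + 2) • countRank G (k + 2) +
      (qCoeff ^ (k + 1) * (qCoeff - 1)) • countRank G (k + 1) +
      ((qCoeff ^ Fintype.card V - qCoeff ^ k) * qCoeff) • countRank G k := by
  ext q
  simp only [Pi.add_apply, coeff_smul_apply, map_mul, map_sub, map_pow, map_one, coeffEval_qCoeff]
  have := card_rankPoints_addIsolated q.Fq G k
  rw [q.card_Fq] at this
  exact this

theorem countZ_mem [Fintype V] [DecidableEq V] (G : SimpleGraph V) : countZ G ∈ GraphsStar := by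
  let e := Fintype.equivFin V
  refine Submodule.subset_span ⟨_, G.map e.toEmbedding, funext fun q => ?_⟩
  refine congrArg Nat.cast (Nat.card_congr ((Matrix.reindex e e).subtypeEquiv fun M => ?_))
  refine and_congr ?_ (and_congr ?_ ?_)
  · simp only [Matrix.IsSymm.ext_iff]
    exact ⟨fun h i j => h _ _, fun h v w => by simpa using h (e v) (e w)⟩
  · rw [Matrix.det_reindex_self]
  · simp only [SimpleGraph.map_adj]
    constructor
    · rintro h _ _ ⟨v, w, hvw, rfl, rfl⟩
      simpa using h v w hvw
    · intro h v w hvw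
      simpa using h _ _ ⟨v, w, hvw, rfl, rfl⟩

theorem rank_eq_card_iff_isUnit_det {K : Type*} [Field K] [Fintype V] [DecidableEq V]
    {M : Matrix V V K} : M.rank = Fintype.card V ↔ IsUnit M.det := by
  rw [← Matrix.isUnit_iff_isUnit_det, ← Matrix.linearIndependent_cols_iff_isUnit,
    linearIndependent_iff_card_eq_finrank_span, Matrix.rank_eq_finrank_span_cols, eq_comm]
  rfl

theorem countRank_card [Fintype V] [DecidableEq V] (G : SimpleGraph V) :
    countRank G (Fintype.card V) = countZ G := by
  funext q
  refine congrArg Nat.cast (Nat.card_congr (Equiv.setCongr (Set.ext fun M => ?_)))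
  simp only [rankPoints, symPoints, ZPoints, Set.mem_ofPred_eq, rank_eq_card_iff_isUnit_det]
  tauto

theorem countRank_of_card_lt [Fintype V] (G : SimpleGraph V) {k : ℕ} (hk : Fintype.card V < k) :
    countRank G k = 0 := by
  funext q
  have : rankPoints q.Fq G k = ∅ := by
    ext M
    simp only [rankPoints, Set.mem_ofPred_eq, Set.mem_empty_iff_false, iff_false, not_and]
    have := M.rank_le_card_width
    omega
  simp [countRank, this]

/-- Induction on the corank `n - k`, over all graphs at once because the vertex set grows. The
bordered matrix has corank `(n + 1) - (k + 2)`, one less. The term of rank `k + 2` on `G` may exceed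
the size `n`, whence the third case. -/
theorem countRank_mem [Fintype V] (G : SimpleGraph V) (k : ℕ) : countRank G k ∈ GraphsStar := by
  classical
  suffices h : ∀ d : ℕ, ∀ (W : Type _) [Fintype W] (G : SimpleGraph W) (k : ℕ),
      Fintype.card W - k = d → countRank G k ∈ GraphsStar from h _ V G k rfl
  intro d
  induction d using Nat.strong_induction_on with
  | _ d ih =>
    intro W _ G k hd
    rcases lt_trichotomy k (Fintype.card W) with hk | rfl | hk
    · refine mem_GraphsStar_of_isUnit_smul ((isUnit_qCoeff_pow_sub_pow hk).mul isUnit_qCoeff) ?_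
      rw [eq_sub_of_add_eq' (countRank_addIsolated G k).symm]
      refine sub_mem (ih _ ?_ (Option W) _ _ rfl) (add_mem
        (Submodule.smul_mem _ _ (ih _ ?_ W _ _ rfl)) (Submodule.smul_mem _ _ (ih _ ?_ W _ _ rfl)))
      · rw [Fintype.card_option]; omega
      all_goals omega
    · rw [countRank_card]
      exact countZ_mem G
    · rw [countRank_of_card_lt G hk]
      exact zero_mem _

end RankPoints

/-! ### Configurations of vectors of given total rank -/

/-! ### Gram matrices of spanning configurations -/

section Gram

variable {K V : Type*} [Field K] {s : ℕ}

theorem forall_mem_span_row_iff {l m n : Type*} [Fintype m] {F : Matrix n l K}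
    {M : Matrix m l K} :
    (∀ i, F i ∈ Submodule.span K (Set.range M.row)) ↔ ∃ B : Matrix n m K, B * M = F := by
  simp only [← range_vecMulLinear, LinearMap.mem_range]
  constructor
  · intro h
    choose B hB using h
    exact ⟨Matrix.of B, funext hB⟩
  · rintro ⟨B, rfl⟩ i
    exact ⟨B i, rfl⟩

variable [Fintype V]

theorem exists_mul_eq_one_of_rank_eq {F : Matrix (Fin s) V K} (h : F.rank = s) :
    ∃ G : Matrix V (Fin s) K, F * G = 1 := by
  rw [← Matrix.mulVec_surjective_iff_exists_right_inverse]
  have : LinearMap.range F.mulVecLin = ⊤ :=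
    Submodule.eq_top_of_finrank_eq (by rw [finrank_fin_fun]; exact h)
  exact LinearMap.range_eq_top.mp this

theorem linearIndependent_row_iff_rank_eq {F : Matrix (Fin s) V K} :
    LinearIndependent K F.row ↔ F.rank = s := by
  rw [linearIndependent_iff_card_eq_finrank_span, Matrix.rank_eq_finrank_span_row, Fintype.card_fin,
    eq_comm]
  rfl

theorem rank_transpose_mul_mul {F : Matrix (Fin s) V K} (hF : F.rank = s)
    {A : Matrix (Fin s) (Fin s) K} (hA : IsUnit A.det) : (F.transpose * A * F).rank = s := by
  obtain ⟨G, hG⟩ := exists_mul_eq_one_of_rank_eq hF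
  refine le_antisymm ((Matrix.rank_mul_le_right _ _).trans hF.le) ?_
  have h1 : G.transpose * (F.transpose * A * F) * G = A := by
    rw [← Matrix.mul_assoc, ← Matrix.mul_assoc, ← Matrix.transpose_mul, hG, Matrix.transpose_one,
      Matrix.one_mul, Matrix.mul_assoc, hG, Matrix.mul_one]
  calc s = A.rank := by rw [rank_eq_card_iff_isUnit_det.mpr hA, Fintype.card_fin]
    _ = (G.transpose * (F.transpose * A * F) * G).rank := by rw [h1]
    _ ≤ _ := (Matrix.rank_mul_le_left _ _).trans (Matrix.rank_mul_le_right _ _)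

theorem exists_mul_transpose_mul_mul {F : Matrix (Fin s) V K} (hF : F.rank = s)
    {A : Matrix (Fin s) (Fin s) K} (hA : IsUnit A.det) :
    ∃ B : Matrix (Fin s) V K, B * (F.transpose * A * F) = F := by
  obtain ⟨G, hG⟩ := exists_mul_eq_one_of_rank_eq hF
  refine ⟨A⁻¹ * G.transpose, ?_⟩
  have h : G.transpose * F.transpose = 1 := by rw [← Matrix.transpose_mul, hG, Matrix.transpose_one]
  calc A⁻¹ * G.transpose * (F.transpose * A * F)
      = A⁻¹ * (G.transpose * F.transpose) * A * F := by simp only [Matrix.mul_assoc]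
    _ = F := by rw [h, Matrix.mul_one, Matrix.nonsing_inv_mul _ hA, Matrix.one_mul]

theorem eq_of_transpose_mul_mul_eq {F : Matrix (Fin s) V K} (hF : F.rank = s)
    {A A' : Matrix (Fin s) (Fin s) K} (h : F.transpose * A * F = F.transpose * A' * F) :
    A = A' := by
  obtain ⟨G, hG⟩ := exists_mul_eq_one_of_rank_eq hF
  have key : ∀ A : Matrix (Fin s) (Fin s) K, G.transpose * (F.transpose * A * F) * G = A := by
    intro A
    rw [← Matrix.mul_assoc, ← Matrix.mul_assoc, ← Matrix.transpose_mul, hG, Matrix.transpose_one,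
      Matrix.one_mul, Matrix.mul_assoc, hG, Matrix.mul_one]
  rw [← key A, h, key]

/-- The rows of `F` form a basis of the row space of `M`. With `G` a right inverse of `F`,
multiplication by `G * F` on the right fixes that row space. Using symmetry on the other side gives
`A = Gᵀ M G`. -/
theorem exists_transpose_mul_mul_eq {M : Matrix V V K} (hM : M.IsSymm) (hr : M.rank = s)
    {F : Matrix (Fin s) V K} (hF : F.rank = s)
    (h : ∀ i, F i ∈ Submodule.span K (Set.range M.row)) :
    ∃ A : Matrix (Fin s) (Fin s) K, A.IsSymm ∧ IsUnit A.det ∧ F.transpose * A * F = M := by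
  obtain ⟨G, hG⟩ := exists_mul_eq_one_of_rank_eq hF
  have hspan : Submodule.span K (Set.range F.row) = Submodule.span K (Set.range M.row) := by
    refine Submodule.eq_of_le_of_finrank_eq (Submodule.span_le.mpr ?_) ?_
    · rintro _ ⟨i, rfl⟩
      exact h i
    · rw [← Matrix.rank_eq_finrank_span_row, ← Matrix.rank_eq_finrank_span_row, hF, hr]
  obtain ⟨C, hC⟩ : ∃ C : Matrix V (Fin s) K, C * F = M := by
    rw [← forall_mem_span_row_iff, hspan]
    exact fun v => Submodule.subset_span ⟨v, rfl⟩
  have h1 : M * G * F = M := by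
    rw [← hC, Matrix.mul_assoc C, hG, Matrix.mul_one]
  have h2 : F.transpose * (G.transpose * M * G) * F = M := by
    calc F.transpose * (G.transpose * M * G) * F
        = F.transpose * G.transpose * (M * G * F) := by simp only [Matrix.mul_assoc]
      _ = F.transpose * G.transpose * M := by rw [h1]
      _ = (M * G * F).transpose := by
        rw [Matrix.transpose_mul, Matrix.transpose_mul, hM.eq, Matrix.mul_assoc]
      _ = M := by rw [h1, hM.eq]
  refine ⟨G.transpose * M * G, ?_, ?_, h2⟩
  · rw [Matrix.IsSymm, Matrix.transpose_mul, Matrix.transpose_mul, hM.eq, Matrix.transpose_transpose,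
      Matrix.mul_assoc]
  · rw [← rank_eq_card_iff_isUnit_det]
    refine le_antisymm (Matrix.rank_le_card_width _) ?_
    rw [Fintype.card_fin]
    nth_rw 1 [← hr]
    nth_rw 1 [← h2]
    exact (Matrix.rank_mul_le_left _ _).trans (Matrix.rank_mul_le_right _ _)

end Gram

/-! ### Counting configurations by the dimension of their span -/

section SpanPoints

variable (K : Type*) [Field K] {V : Type*}

instance finite_bilinForm [Finite K] (s : ℕ) : Finite (LinearMap.BilinForm K (Fin s → K)) :=
  Finite.of_equiv _ (Matrix.toBilin' (R₁ := K) (n := Fin s)).toEquiv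

/-- The points of `J_G(s)` whose vectors span a subspace of dimension `r`. -/
def spanPoints (G : SimpleGraph V) (s r : ℕ) :
    Set (LinearMap.BilinForm K (Fin s → K) × (V → Fin s → K)) :=
  {x | x ∈ JPoints K G s ∧ finrank K (Submodule.span K (Set.range x.2)) = r}

theorem gram_eq [Fintype V] {s : ℕ} (Q : LinearMap.BilinForm K (Fin s → K)) (f : V → Fin s → K) :
    (Matrix.of fun v w => Q (f v) (f w)) =
      (Matrix.of f).transpose.transpose * LinearMap.BilinForm.toMatrix' Q *
        (Matrix.of f).transpose := by
  ext v w
  conv_lhs => rw [← Matrix.toBilin'_toMatrix' Q]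
  rw [Matrix.of_apply, Matrix.toBilin'_apply', Matrix.dotProduct_mulVec]
  rfl

theorem isUnit_det_toMatrix'_iff {s : ℕ} {Q : LinearMap.BilinForm K (Fin s → K)} :
    IsUnit (LinearMap.BilinForm.toMatrix' Q).det ↔ Q.Nondegenerate := by
  rw [← LinearMap.BilinForm.nondegenerate_toMatrix'_iff, Matrix.nondegenerate_iff_det_ne_zero,
    isUnit_iff_ne_zero]

theorem rank_transpose_of [Fintype V] {s : ℕ} (f : V → Fin s → K) :
    (Matrix.of f).transpose.rank = finrank K (Submodule.span K (Set.range f)) :=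
  Matrix.rank_eq_finrank_span_cols _

/-- A spanning configuration is determined by its Gram matrix together with a basis of the row
space of the Gram matrix. -/
def spanPointsEquiv [Fintype V] (G : SimpleGraph V) (s : ℕ) :
    spanPoints K G s s ≃ {x : Matrix V V K × (Fin s → V → K) // x.1 ∈ rankPoints K G s ∧
      LinearIndependent K x.2 ∧ ∀ i, x.2 i ∈ Submodule.span K (Set.range x.1.row)} :=
  Equiv.ofBijective
    (fun x => ⟨(Matrix.of fun v w => x.1.1 (x.1.2 v) (x.1.2 w), (Matrix.of x.1.2).transpose), by
      obtain ⟨⟨Q, f⟩, ⟨hs, hn, hG⟩, hr⟩ := x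
      dsimp only at hs hn hG hr ⊢
      rw [← rank_transpose_of] at hr
      rw [← isUnit_det_toMatrix'_iff] at hn
      refine ⟨⟨⟨?_, hG⟩, ?_⟩, linearIndependent_row_iff_rank_eq.mpr hr, ?_⟩
      · exact Matrix.IsSymm.ext fun v w => hs.eq _ _
      · rw [gram_eq, rank_transpose_mul_mul hr hn]
      · rw [gram_eq, forall_mem_span_row_iff]
        exact exists_mul_transpose_mul_mul hr hn⟩)
    (by
      constructor
      · rintro ⟨⟨Q, f⟩, ⟨hs, hn, hG⟩, hr⟩ ⟨⟨Q', f'⟩, ⟨hs', hn', hG'⟩, hr'⟩ h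
        have h1 : (Matrix.of fun v w => Q (f v) (f w)) = Matrix.of fun v w => Q' (f' v) (f' w) :=
          congrArg (fun x => x.1.1) h
        have hf : f = f' := Matrix.transpose_injective (congrArg (fun x => x.1.2) h)
        subst hf
        simp only [gram_eq] at h1
        dsimp only at hr
        rw [← rank_transpose_of] at hr
        have := LinearMap.BilinForm.toMatrix'.injective (eq_of_transpose_mul_mul_eq hr h1)
        subst this
        rfl
      · rintro ⟨⟨M, F⟩, ⟨⟨hM, hG⟩, hr⟩, hli, hmem⟩
        dsimp only at hM hG hr hli hmem
        have hF : (Matrix.of F).rank = s := linearIndependent_row_iff_rank_eq.mp hli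
        obtain ⟨A, hA, hu, hFA⟩ := exists_transpose_mul_mul_eq hM hr hF hmem
        have hgram :
            (Matrix.of fun v w => Matrix.toBilin' A (fun i => F i v) (fun i => F i w)) = M := by
          rw [gram_eq, LinearMap.BilinForm.toMatrix'_toBilin']
          exact hFA
        refine ⟨⟨(Matrix.toBilin' A, fun v i => F i v), ⟨?_, ?_, ?_⟩, ?_⟩, ?_⟩
        · exact Matrix.isSymm_toBilin'_iff_isSymm.mpr hA
        · rw [← isUnit_det_toMatrix'_iff]
          simpa using hu
        · intro v w hvw
          rw [← hG v w hvw, ← hgram]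
          rfl
        · rw [← rank_transpose_of]
          exact hF
        · exact Subtype.ext (Prod.ext hgram rfl))

theorem card_linearIndependent_mem [Finite K] {E : Type*} [AddCommGroup E] [Module K E] [Finite E]
    (W : Submodule K E) :
    (Nat.card {F : Fin (finrank K W) → E // LinearIndependent K F ∧ ∀ i, F i ∈ W} : ℚ) =
      ∏ i : Fin (finrank K W), ((Nat.card K : ℚ) ^ finrank K W - (Nat.card K : ℚ) ^ (i : ℕ)) := by
  have := Fintype.ofFinite K
  have e : {F : Fin (finrank K W) → E // LinearIndependent K F ∧ ∀ i, F i ∈ W} ≃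
      {F : Fin (finrank K W) → W // LinearIndependent K F} :=
    { toFun := fun F => ⟨fun i => ⟨F.1 i, F.2.2 i⟩,
        LinearIndependent.of_comp W.subtype F.2.1⟩
      invFun := fun F => ⟨fun i => F.1 i,
        F.2.map' W.subtype W.ker_subtype, fun i => (F.1 i).2⟩
      left_inv := fun _ => rfl
      right_inv := fun _ => rfl }
  rw [Nat.card_congr e, card_linearIndependent le_rfl, Nat.cast_prod]
  refine Finset.prod_congr rfl fun i _ => ?_
  rw [Nat.cast_sub (Nat.pow_le_pow_right Fintype.card_pos i.2.le), Nat.card_eq_fintype_card,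
    Nat.cast_pow, Nat.cast_pow]

/-- Each Gram matrix contributes the ordered bases of an `s`-dimensional space, a number independent
of the matrix. -/
theorem card_spanPoints_self [Finite K] [Fintype V] (G : SimpleGraph V) (s : ℕ) :
    (Nat.card (spanPoints K G s s) : ℚ) =
      (∏ i : Fin s, ((Nat.card K : ℚ) ^ s - (Nat.card K : ℚ) ^ (i : ℕ))) *
        Nat.card (rankPoints K G s) := by
  have := Fintype.ofFinite {M // M ∈ rankPoints K G s}
  rw [Nat.card_congr (spanPointsEquiv K G s),
    card_subtype_prod _ (fun (M : Matrix V V K) (F : Fin s → V → K) => LinearIndependent K F ∧ ∀ i, F i ∈ Submodule.span K (Set.range M.row)), Nat.cast_sum]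
  have h : ∀ M : {M // M ∈ rankPoints K G s},
      (Nat.card {F : Fin s → V → K // LinearIndependent K F ∧
        ∀ i, F i ∈ Submodule.span K (Set.range M.1.row)} : ℚ) =
      ∏ i : Fin s, ((Nat.card K : ℚ) ^ s - (Nat.card K : ℚ) ^ (i : ℕ)) := by
    intro M
    have hr := M.2.2
    rw [Matrix.rank_eq_finrank_span_row] at hr
    have := card_linearIndependent_mem K (Submodule.span K (Set.range M.1.row))
    rw [hr] at this
    exact this
  rw [Finset.sum_congr rfl fun M _ => h M, Finset.sum_const, Finset.card_univ, nsmul_eq_mul,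
    mul_comm, ← Nat.card_eq_fintype_card]

/-- Splitting off the vector at an added isolated vertex. -/
def spanPointsAddIsolatedEquiv (G : SimpleGraph V) (s r : ℕ) :
    spanPoints K (addIsolated G) s r ≃
      {x : (LinearMap.BilinForm K (Fin s → K) × (V → Fin s → K)) × (Fin s → K) //
        x.1 ∈ JPoints K G s ∧
          finrank K (Submodule.span K (insert x.2 (Set.range x.1.2))) = r} where
  toFun x := ⟨((x.1.1, fun v => x.1.2 (some v)), x.1.2 none),
    ⟨x.2.1.1, x.2.1.2.1, (addIsolated_adj_forall G _).mp x.2.1.2.2⟩, by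
      have := x.2.2
      rwa [Option.range_eq] at this⟩
  invFun x := ⟨(x.1.1.1, fun v => v.elim x.1.2 x.1.1.2),
    ⟨x.2.1.1, x.2.1.2.1, (addIsolated_adj_forall G _).mpr x.2.1.2.2⟩, by
      rw [Option.range_eq]
      exact x.2.2⟩
  left_inv x := Subtype.ext (Prod.ext rfl (funext fun v => by cases v <;> rfl))
  right_inv _ := rfl

/-- Dimension `r + 1` arises from a vector inside a span of dimension `r + 1` or outside one of
dimension `r`. -/
theorem card_finrank_span_insert [Finite K] {E : Type*} [AddCommGroup E] [Module K E] [Finite E]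
    (S : Set E) (r : ℕ) :
    (Nat.card {y // finrank K (Submodule.span K (insert y S)) = r + 1} : ℚ) =
      (if finrank K (Submodule.span K S) = r + 1 then (Nat.card K : ℚ) ^ (r + 1) else 0) +
      (if finrank K (Submodule.span K S) = r then
        (Nat.card K : ℚ) ^ finrank K E - (Nat.card K : ℚ) ^ r else 0) := by
  classical
  have hcard : Nat.card {y // y ∈ Submodule.span K S} =
      Nat.card K ^ finrank K (Submodule.span K S) :=
    Module.natCard_eq_pow_finrank (K := K) (V := Submodule.span K S)
  by_cases h1 : finrank K (Submodule.span K S) = r + 1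
  · have h : ∀ y, finrank K (Submodule.span K (insert y S)) = r + 1 ↔ y ∈ Submodule.span K S := by
      intro y
      rw [finrank_span_insert, h1]
      split_ifs <;> simp_all
    rw [Nat.card_congr (Equiv.subtypeEquivRight h), hcard]
    simp [h1]
  by_cases h0 : finrank K (Submodule.span K S) = r
  · have h : ∀ y, finrank K (Submodule.span K (insert y S)) = r + 1 ↔
        ¬ y ∈ Submodule.span K S := by
      intro y
      rw [finrank_span_insert, h0]
      split_ifs <;> simp_all
    have hle : Nat.card K ^ r ≤ Nat.card K ^ finrank K E :=
      Nat.pow_le_pow_right Nat.card_pos (h0 ▸ Submodule.finrank_le _)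
    rw [Nat.card_congr (Equiv.subtypeEquivRight h), card_notMem, hcard, h0,
      Module.natCard_eq_pow_finrank (K := K) (V := E), Nat.cast_sub hle]
    simp
  · have h : ∀ y, finrank K (Submodule.span K (insert y S)) ≠ r + 1 := by
      intro y
      rw [finrank_span_insert]
      split_ifs <;> omega
    simp [h, h0, h1]

theorem card_spanPoints_addIsolated [Finite K] [Finite V] (G : SimpleGraph V) (s r : ℕ) :
    (Nat.card (spanPoints K (addIsolated G) s (r + 1)) : ℚ) =
      (Nat.card K : ℚ) ^ (r + 1) * Nat.card (spanPoints K G s (r + 1)) +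
      ((Nat.card K : ℚ) ^ s - (Nat.card K : ℚ) ^ r) * Nat.card (spanPoints K G s r) := by
  classical
  have := Fintype.ofFinite {x // x ∈ JPoints K G s}
  rw [Nat.card_congr (spanPointsAddIsolatedEquiv K G s (r + 1)),
    card_subtype_prod _ (fun (x : LinearMap.BilinForm K (Fin s → K) × (V → Fin s → K))
      (y : Fin s → K) => finrank K (Submodule.span K (insert y (Set.range x.2))) = r + 1),
    Nat.cast_sum, Finset.sum_congr rfl fun x _ => card_finrank_span_insert K _ r,
    Finset.sum_add_distrib, finrank_fin_fun,
    sum_subtype_ite _ (fun x : LinearMap.BilinForm K (Fin s → K) × (V → Fin s → K) =>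
      finrank K (Submodule.span K (Set.range x.2)) = r + 1),
    sum_subtype_ite _ (fun x : LinearMap.BilinForm K (Fin s → K) × (V → Fin s → K) =>
      finrank K (Submodule.span K (Set.range x.2)) = r)]
  rfl

theorem card_JPoints_eq_sum [Finite K] [Finite V] (G : SimpleGraph V) (s : ℕ) :
    (Nat.card (JPoints K G s) : ℚ) =
      ∑ r ∈ Finset.range (s + 1), (Nat.card (spanPoints K G s r) : ℚ) := by
  classical
  have := Fintype.ofFinite {x // x ∈ JPoints K G s}
  have h : ∀ r, (Nat.card (spanPoints K G s r) : ℚ) = ∑ x : {x // x ∈ JPoints K G s},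
      if finrank K (Submodule.span K (Set.range x.1.2)) = r then 1 else 0 := by
    intro r
    rw [sum_subtype_ite _ (fun x : LinearMap.BilinForm K (Fin s → K) × (V → Fin s → K) =>
      finrank K (Submodule.span K (Set.range x.2)) = r), one_mul]
    rfl
  simp only [h]
  rw [Finset.sum_comm, Finset.sum_congr rfl fun x _ => Finset.sum_ite_eq _ _ _]
  have hle : ∀ x : {x // x ∈ JPoints K G s},
      finrank K (Submodule.span K (Set.range x.1.2)) ∈ Finset.range (s + 1) := by
    intro x
    have := Submodule.finrank_le (Submodule.span K (Set.range x.1.2))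
    rw [finrank_fin_fun] at this
    simpa using Nat.lt_succ_of_le this
  simp only [hle, if_true, Finset.sum_const, Finset.card_univ, nsmul_eq_mul, mul_one,
    ← Nat.card_eq_fintype_card]

end SpanPoints

variable {V : Type*}

/-- The function counting the points of `J_G(s)` whose vectors span a subspace of dimension `r`. -/
def countSpan (G : SimpleGraph V) (s r : ℕ) : CountFun :=
  fun q => (Nat.card (spanPoints q.Fq G s r) : ℚ)

/-- The function counting the points of `J_G(s)`. -/
def countJFree (G : SimpleGraph V) (s : ℕ) : CountFun :=
  fun q => (Nat.card (JPoints q.Fq G s) : ℚ)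

theorem countSpan_self [Fintype V] (G : SimpleGraph V) (s : ℕ) :
    countSpan G s s = (∏ i : Fin s, (qCoeff ^ s - qCoeff ^ (i : ℕ))) • countRank G s := by
  ext q
  simp only [coeff_smul_apply, map_prod, map_sub, map_pow, coeffEval_qCoeff]
  have := card_spanPoints_self q.Fq G s
  rw [q.card_Fq] at this
  exact this

theorem countSpan_addIsolated [Finite V] (G : SimpleGraph V) (s r : ℕ) :
    countSpan (addIsolated G) s (r + 1) =
      qCoeff ^ (r + 1) • countSpan G s (r + 1) + (qCoeff ^ s - qCoeff ^ r) • countSpan G s r := by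
  ext q
  simp only [Pi.add_apply, coeff_smul_apply, map_sub, map_pow, coeffEval_qCoeff]
  have := card_spanPoints_addIsolated q.Fq G s r
  rw [q.card_Fq] at this
  exact this

/-- Descending induction on `r` from the spanning case `r = s`. Below it, `q ^ s - q ^ r` is a unit,
so `countSpan_addIsolated` can be solved for `countSpan G s r`. -/
theorem countSpan_mem [Finite V] (G : SimpleGraph V) {s r : ℕ} (hr : r ≤ s) :
    countSpan G s r ∈ GraphsStar := by
  suffices h : ∀ d : ℕ, ∀ (W : Type _) [Finite W] (G : SimpleGraph W) (r : ℕ),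
      r + d = s → countSpan G s r ∈ GraphsStar from h (s - r) V G r (by omega)
  intro d
  induction d with
  | zero =>
    rintro W _ G _ rfl
    have := Fintype.ofFinite W
    rw [add_zero, countSpan_self]
    exact Submodule.smul_mem _ _ (countRank_mem G _)
  | succ d ih =>
    intro W _ G r hd
    refine mem_GraphsStar_of_isUnit_smul (isUnit_qCoeff_pow_sub_pow (show r < s by omega)) ?_
    rw [eq_sub_of_add_eq' (countSpan_addIsolated G s r).symm]
    exact sub_mem (ih (Option W) _ _ (by omega))
      (Submodule.smul_mem _ _ (ih W _ _ (by omega)))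

theorem countJFree_mem [Finite V] (G : SimpleGraph V) (s : ℕ) : countJFree G s ∈ GraphsStar := by
  have : countJFree G s = ∑ r ∈ Finset.range (s + 1), countSpan G s r := by
    ext q
    rw [Finset.sum_apply]
    exact card_JPoints_eq_sum q.Fq G s
  rw [this]
  exact sum_mem fun r hr => countSpan_mem G (by simpa [Nat.lt_succ_iff] using hr)

/-! ### Rank conditions -/

/-- The graph `G` with `a H` new vertices attached to all elements of `H`, for each `H ∈ U`. -/
def attach {V : Type*} (G : SimpleGraph V) {U : Set (Set V)} (a : U → ℕ) :
    SimpleGraph (V ⊕ (Σ H : U, Fin (a H))) where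
  Adj
    | .inl v, .inl w => G.Adj v w
    | .inl v, .inr p => v ∈ p.1.1
    | .inr p, .inl v => v ∈ p.1.1
    | .inr _, .inr _ => False
  symm := ⟨by
    rintro (v | p) (w | p') h
    exacts [G.adj_symm h, h, h, h]⟩
  loopless := ⟨by
    rintro (v | p) h
    exacts [G.loopless.irrefl v h, h]⟩

section Points

variable (K : Type*) [Field K] {V : Type*} {U : Set (Set V)}

/-- A point of `J` for the graph with attached vertices is a point of `J_G(s)` together with, for
each new vertex, a vector orthogonal to the vectors it is attached to. -/
def JPointsAttachEquiv (G : SimpleGraph V) (s : ℕ) (a : U → ℕ) :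
    JPoints K (attach G a) s ≃ (Σ x : {x // x ∈ JPoints K G s}, ∀ p : (Σ H : U, Fin (a H)),
      x.1.1.orthogonal (Submodule.span K (x.1.2 '' (p.1 : Set V)))) where
  toFun x := ⟨⟨(x.1.1, fun v => x.1.2 (.inl v)), x.2.1, x.2.2.1,
      fun v w h => x.2.2.2 (.inl v) (.inl w) h⟩, fun p => ⟨x.1.2 (.inr p), by
        rw [LinearMap.BilinForm.mem_orthogonal_iff]
        intro y hy
        -- Orthogonality to a fixed vector is membership in a kernel, so it need only be checked on
        -- the generators of the span.
        change y ∈ LinearMap.ker (x.1.1.flip (x.1.2 (.inr p)))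
        refine Submodule.span_le.mpr ?_ hy
        rintro _ ⟨v, hv, rfl⟩
        exact x.2.2.2 (.inl v) (.inr p) hv⟩⟩
  invFun x := ⟨(x.1.1.1, Sum.elim x.1.1.2 fun p => (x.2 p).1), x.1.2.1, x.1.2.2.1, by
    have key : ∀ (v : V) (p : Σ H : U, Fin (a H)), v ∈ p.1.1 →
        x.1.1.1 (x.1.1.2 v) (x.2 p).1 = 0 := fun v p hv =>
      LinearMap.BilinForm.mem_orthogonal_iff.mp (x.2 p).2 _ (Submodule.subset_span ⟨v, hv, rfl⟩)
    rintro (v | p) (w | p') h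
    · exact x.1.2.2.2 v w h
    · exact key v p' h
    · exact (x.1.2.1.eq _ _).trans (key w p h)
    · exact h.elim⟩
  left_inv x := Subtype.ext (Prod.ext rfl (funext fun v => by cases v <;> rfl))
  right_inv _ := rfl

/-- New vertices are pairwise nonadjacent, so their vectors are chosen independently. Nondegeneracy
gives each orthogonal complement dimension `s` minus the rank. -/
theorem card_JPoints_attach [Finite K] [Finite V] [Fintype U] (G : SimpleGraph V) (s : ℕ)
    (a : U → ℕ) [Fintype {x // x ∈ JPoints K G s}] :
    Nat.card (JPoints K (attach G a) s) = ∑ x : {x // x ∈ JPoints K G s}, ∏ H : U,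
      (Nat.card K ^ (s - finrank K (Submodule.span K (x.1.2 '' (H : Set V))))) ^ a H := by
  rw [Nat.card_congr (JPointsAttachEquiv K G s a), Nat.card_sigma]
  refine Finset.sum_congr rfl fun x _ => ?_
  rw [Nat.card_pi, Fintype.prod_sigma]
  refine Finset.prod_congr rfl fun H _ => ?_
  dsimp only
  rw [Finset.prod_const, Finset.card_univ, Fintype.card_fin,
    Module.natCard_eq_pow_finrank (K := K), LinearMap.BilinForm.finrank_orthogonal x.2.2.1,
    finrank_fin_fun]

end Points

theorem exists_rank_indicator (s r : ℕ) : ∃ P : CoeffRing[X], ∀ t ≤ s,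
    P.eval (qCoeff ^ (s - t)) = if t = r then 1 else 0 := by
  by_cases hr : r ≤ s
  · obtain ⟨P, hP⟩ := exists_lagrange s (s - r)
    refine ⟨P, fun t ht => ?_⟩
    rw [hP _ (Nat.sub_le _ _)]
    exact if_congr (by omega) rfl rfl
  -- A prescribed rank `r > s` is never attained, so its indicator is zero; truncated `s - r` would
  -- wrongly select `t = s`.
  · exact ⟨0, fun t ht => by rw [eval_zero, if_neg (by omega)]⟩

/-- Write the rank conditions as a product of the polynomials `P H` at `q ^ (s - rk f(H))` and
expand. Summed over the points of `J_G(s)`, the monomial with exponents `a` is the point count for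
`attach G a`. -/
theorem countJ_eq_sum {V : Type*} [Finite V] (G : SimpleGraph V) (s : ℕ) {U : Set (Set V)}
    [Fintype U] [DecidableEq U] (π : U → ℕ) {P : U → CoeffRing[X]}
    (hP : ∀ H, ∀ t ≤ s, (P H).eval (qCoeff ^ (s - t)) = if t = π H then 1 else 0) :
    countJ G s π = ∑ a ∈ Fintype.piFinset fun H => (P H).support,
      (∏ H, (P H).coeff (a H)) • countJFree (attach G a) s := by
  classical
  ext q
  have := Fintype.ofFinite {x // x ∈ JPoints q.Fq G s}
  let rk : {x // x ∈ JPoints q.Fq G s} → U → ℕ := fun x H =>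
    finrank q.Fq (Submodule.span q.Fq (x.1.2 '' (H : Set V)))
  have hrk : ∀ x H, rk x H ≤ s := fun x H =>
    (Submodule.finrank_le _).trans (finrank_fin_fun _).le
  have hL : countJ G s π q = ∑ x, ∏ H, if rk x H = π H then (1 : ℚ) else 0 := by
    have h1 : ∀ x, (∏ H, if rk x H = π H then (1 : ℚ) else 0) =
        if ∀ H, rk x H = π H then 1 else 0 := by
      intro x
      simp [Finset.prod_ite_zero]
    simp only [h1]
    refine Eq.trans ?_ (sum_subtype_ite (· ∈ JPoints q.Fq G s) (fun x => ∀ H : U,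
      finrank q.Fq (Submodule.span q.Fq (x.2 '' (H : Set V))) = π H) 1).symm
    rw [one_mul]
    rfl
  have hR : ∀ a : U → ℕ, countJFree (attach G a) s q =
      ∑ x, ∏ H, (((q : ℕ) : ℚ) ^ (s - rk x H)) ^ a H := by
    intro a
    rw [countJFree, card_JPoints_attach, q.card_Fq]
    push_cast
    rfl
  have hI : ∀ x H, (if rk x H = π H then (1 : ℚ) else 0) = ∑ j ∈ (P H).support,
      coeffEval q ((P H).coeff j) * (((q : ℕ) : ℚ) ^ (s - rk x H)) ^ j := by
    intro x H
    have := congrArg (coeffEval q) (hP H _ (hrk x H))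
    rw [eval_eq_sum, Polynomial.sum, map_sum] at this
    simp only [map_mul, map_pow, coeffEval_qCoeff, apply_ite (coeffEval q), map_one,
      map_zero] at this
    exact this.symm
  rw [hL, Finset.sum_apply]
  simp only [coeff_smul_apply, hR, hI, Finset.prod_univ_sum, Finset.mul_sum, map_prod,
    ← Finset.prod_mul_distrib]
  exact Finset.sum_comm

end GraphMotives

end

theorem mainTheorem7 {V : Type*} [Finite V] (G : SimpleGraph V) (s : ℕ)
    (U : Set (Set V)) (π : U → ℕ) :
    GraphMotives.countJ G s π ∈ GraphMotives.GraphsStar := by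
  classical
  have := Fintype.ofFinite U
  choose P hP using fun H => GraphMotives.exists_rank_indicator s (π H)
  rw [GraphMotives.countJ_eq_sum G s π hP]
  exact sum_mem fun a _ => Submodule.smul_mem _ _ (GraphMotives.countJFree_mem _ _)
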